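/- Let $[n]=\{1,\dots,n\}$ with $n\ge 2$, let $H(\mathbf p)=-\sum_i p_i\log_2 p_i$ be the Shannon entropy and $d_H(\mathbf p,\mathbf q)=\sqrt{\frac12\sum_i(\sqrt{p_i}-\sqrt{q_i})^2}$ the Hellinger distance. For $\epsilon\in[0,1]$ put $\mathbf p_\epsilon=(1-\epsilon,\frac{\epsilon}{n-1},\dots,\frac{\epsilon}{n-1})$ and $\tilde{\mathbf p}=(1,0,\dots,0)$. Input models for a distribution $\mathbf p$ on $[n]$: (i) the standard query oracle $|j\rangle|b\rangle\mapsto|j\rangle|b+v_j\rangle$ (labels added modulo $n$, the first label playing the role of $0$) of a string $v\in[n]^m$ with $p_i=\frac1m|\{j:v_j=i\}|$ for all $i$; (ii) the same oracle for a string $v\in[n]^m$ whose entries are drawn independently from $\mathbf p$; (iii) a unitary $U$ on $\mathbb C^n$ with $U|0\rangle=\sum_i\sqrt{p_i}|i\rangle$, where $|0\rangle$ is the first computational basis vector; (iv) a unitary $U$ on $\mathbb C^n\otimes\mathbb C^n$ with $U|0\rangle|0\rangle=\sum_i\sqrt{p_i}|\psi_i\rangle|i\rangle$ for some orthonormal $\psi_1,\dots,\psi_n$.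 A $T$-query algorithm alternates fixed unitaries on the oracle register and a finite-dimensional workspace with $T$ uses of $U$ or $U^\dagger$ (possibly controlled by the workspace), and maps the outcome of a final measurement to a real number. It succeeds on $\mathbf p$ with probability at least $s$ if it does so for every oracle representing $\mathbf p$; in model (ii) the probability is taken over $v$ as well. It distinguishes $\mathbf p_\epsilon$ from $\tilde{\mathbf p}$ if it answers $1$ on $\mathbf p_\epsilon$ and $0$ on $\tilde{\mathbf p}$, each with probability at least $s$; it is a $\gamma$-estimator if for every distribution $\mathbf p$ on $[n]$ its output lies in $[H(\mathbf p)/\gamma,\gamma H(\mathbf p)]$ with probability at least $s$ (in model (i), for every $\mathbf p$ that is the frequency vector of a string of length $m$). (a) For all $n\ge2$ and $\epsilon\in[0,1]$, $\mathbf p_\epsilon$ and $\tilde{\mathbf p}$ are distributions, $d_H(\mathbf p_\epsilon,\tilde{\mathbf p})=\sqrt{1-\sqrt{1-\epsilon}}$ and $\sqrt{\epsilon/2}\le d_H(\mathbf p_\epsilon,\tilde{\mathbf p})\le\sqrt\epsilon$. Moreover $H(\tilde{\mathbf p})=0$ and $H(\mathbf p_\epsilon)=-(1-\epsilon)\log_2(1-\epsilon)-\epsilon\log_2\epsilon+\epsilon\log_2(n-1)$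 (with $0\log_2 0=0$), which is at least $\epsilon\log_2 n$ if $\epsilon\le\frac12$ and at least $\frac\epsilon2\log_2 n$ if $n\ge3$. (b) For every $s>\frac12$ there is $c>0$, depending only on $s$, such that for all $n\ge2$ and in each of the models (i)-(iv) (for every string length $m$ in (i) and (ii)) the following holds. If $0<\epsilon\le1$ (and, in model (i), $\mathbf p_\epsilon$ is the frequency vector of some string of length $m$), then every algorithm distinguishing $\mathbf p_\epsilon$ from $\tilde{\mathbf p}$ makes at least $c/d_H(\mathbf p_\epsilon,\tilde{\mathbf p})$, in particular at least $c/\sqrt\epsilon$, queries; if moreover $\epsilon<1$, then for every $\gamma>1$ every $\gamma$-estimator makes at least $c/\sqrt\epsilon$ queries. With $\epsilon=n^{-k}$, $k>0$ real (again assumed to be representable in model (i)), both kinds of algorithms make at least $c\,n^{k/2}$ queries. (c) Consequently no algorithm making polynomially many queries estimates the entropy of all distributions on $[n]$: for every $s>\frac12$ and all real $C$ and $k>0$ there is $K$ such that for all $n\ge2$, in each of the models (i)-(iv), where in model (i) the string length is assumed to satisfy $m\ge K n^{2k+1}$, and for every $\gamma>1$, no $\gamma$-estimator makes at most $C n^k$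 queries. -/

import Mathlib

open scoped Matrix

noncomputable section

/-- The effect that one oracle query has on the query register: apply `U`, apply `U†`, or do
nothing.  In an algorithm it may be controlled by the state of the workspace. -/
inductive QueryMode where
  | forward
  | inverse
  | skip

/-- The operator on the query register that is selected by a query mode. -/
def QueryMode.op {Q : Type} [Fintype Q] [DecidableEq Q] (U : Matrix Q Q ℂ) :
    QueryMode → Matrix Q Q ℂ
  | .forward => U
  | .inverse => Uᴴ
  | .skip => 1

/-- A quantum query algorithm whose oracle acts on a register with computational basis `Q`.
The algorithm has a workspace of arbitrary finite dimension, starts in a fixed basis state, and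
alternates input-independent unitaries on query register and workspace with `queries` oracle
queries (to `U` or `U†`, possibly controlled by the workspace).  At the end all registers are
measured in the computational basis and the outcome is mapped to a real number. -/
structure QueryAlgorithm (Q : Type) [Fintype Q] [DecidableEq Q] where
  /-- dimension of the workspace -/
  workDim : ℕ
  /-- number of oracle queries -/
  queries : ℕ
  /-- initial basis state -/
  start : Q × Fin workDim
  /-- `gate t` is the unitary that is applied after the first `t` queries -/
  gate : ℕ → Matrix.unitaryGroup (Q × Fin workDim) ℂ
  /-- `mode t w` is the mode of query number `t` (counted from 0) on workspace basis state `w` -/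
  mode : ℕ → Fin workDim → QueryMode
  /-- the number returned for a given measurement outcome -/
  output : Q × Fin workDim → ℝ

namespace QueryAlgorithm

variable {Q : Type} [Fintype Q] [DecidableEq Q]

/-- The operator of query number `t`: on workspace basis state `w` it acts on the query register
as selected by `mode t w`, that is, it is the sum over `w` of `(mode t w).op U ⊗ |w⟩⟨w|`. -/
def queryMatrix (A : QueryAlgorithm Q) (U : Matrix Q Q ℂ) (t : ℕ) :
    Matrix (Q × Fin A.workDim) (Q × Fin A.workDim) ℂ :=
  Matrix.blockDiagonal fun w => (A.mode t w).op U

/-- The amplitudes of the state of the algorithm with oracle `U` after `t` queries. -/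
def state (A : QueryAlgorithm Q) (U : Matrix Q Q ℂ) : ℕ → (Q × Fin A.workDim → ℂ)
  | 0 => (A.gate 0).1 *ᵥ Pi.single A.start 1
  | t + 1 => (A.gate (t + 1)).1 *ᵥ (A.queryMatrix U t *ᵥ A.state U t)

open Classical in
/-- The probability that the algorithm, run with oracle `U`, returns a number in `S`. -/
def outputProb (A : QueryAlgorithm Q) (U : Matrix Q Q ℂ) (S : Set ℝ) : ℝ :=
  ∑ x, if A.output x ∈ S then ‖A.state U A.queries x‖ ^ 2 else 0

end QueryAlgorithm

/-- Shannon entropy (in bits) of a distribution on `n` labels. -/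
def shannonEntropy {n : ℕ} (p : Fin n → ℝ) : ℝ :=
  -∑ i, p i * Real.logb 2 (p i)

/-- Hellinger distance of two distributions on `n` labels. -/
def hellingerDist {n : ℕ} (p q : Fin n → ℝ) : ℝ :=
  √((1 / 2) * ∑ i, (√(p i) - √(q i)) ^ 2)

/-- The distribution `(1 - ε, ε / (n - 1), …, ε / (n - 1))`. -/
def hardDist (n : ℕ) [NeZero n] (ε : ℝ) : Fin n → ℝ :=
  fun i => if i = 0 then 1 - ε else ε / ((n : ℝ) - 1)

/-- The point mass `(1, 0, …, 0)`. -/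
def pointMass (n : ℕ) [NeZero n] : Fin n → ℝ :=
  Pi.single 0 1

/-- The standard query oracle of a string `v` of `m` labels, `|j⟩|b⟩ ↦ |j⟩|b + v j⟩` with addition
modulo `n`; in particular `|j⟩|0⟩ ↦ |j⟩|v j⟩`. -/
def stringOracle {m n : ℕ} (v : Fin m → Fin n) : Matrix (Fin m × Fin n) (Fin m × Fin n) ℂ :=
  Matrix.of fun x y => if x = (y.1, y.2 + v y.1) then 1 else 0

theorem stringOracle_mem_unitaryGroup {m n : ℕ} [NeZero n] (v : Fin m → Fin n) :
    stringOracle v ∈ Matrix.unitaryGroup (Fin m × Fin n) ℂ := by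
  rw [Matrix.mem_unitaryGroup_iff']
  ext x y
  have h : ((x.1, x.2 + v x.1) = (y.1, y.2 + v y.1)) ↔ x = y := by
    constructor
    · intro h
      obtain ⟨h1, h2⟩ := Prod.mk.inj h
      rw [h1] at h2
      exact Prod.ext h1 (add_right_cancel h2)
    · rintro rfl; rfl
  simp only [Matrix.star_eq_conjTranspose, Matrix.mul_apply, Matrix.conjTranspose_apply,
    stringOracle, Matrix.of_apply, apply_ite star, star_one, star_zero, ite_mul, one_mul, zero_mul,
    Finset.sum_ite_eq', Finset.mem_univ, if_true, h, Matrix.one_apply]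

/-- The relative frequencies of the labels in a string of length `m`. -/
def frequencies {m n : ℕ} (v : Fin m → Fin n) : Fin n → ℝ :=
  fun i => ((Finset.univ.filter fun j => v j = i).card : ℝ) / m

/-- The four input models for a distribution `p` on `n` labels: a query oracle to a string of
length `m` with frequency vector `p`; a query oracle to a string of `m` independent samples from
`p`; a unitary that prepares the quantum sample of `p`; purified quantum query access to `p`. -/
inductive InputModel where
  | frequency (m : ℕ)
  | samples (m : ℕ)
  | quantumSample
  | purified

namespace InputModel

/-- The computational basis of the register on which the oracle acts. -/
@[reducible] def Reg : InputModel → ℕ → Type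
  | .frequency m, n => Fin m × Fin n
  | .samples m, n => Fin m × Fin n
  | .quantumSample, n => Fin n
  | .purified, n => Fin n × Fin n

instance instFintypeReg : (M : InputModel) → (n : ℕ) → Fintype (M.Reg n)
  | .frequency m, n => inferInstanceAs (Fintype (Fin m × Fin n))
  | .samples m, n => inferInstanceAs (Fintype (Fin m × Fin n))
  | .quantumSample, n => inferInstanceAs (Fintype (Fin n))
  | .purified, n => inferInstanceAs (Fintype (Fin n × Fin n))

instance instDecidableEqReg : (M : InputModel) → (n : ℕ) → DecidableEq (M.Reg n)
  | .frequency m, n => inferInstanceAs (DecidableEq (Fin m × Fin n))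
  | .samples m, n => inferInstanceAs (DecidableEq (Fin m × Fin n))
  | .quantumSample, n => inferInstanceAs (DecidableEq (Fin n))
  | .purified, n => inferInstanceAs (DecidableEq (Fin n × Fin n))

/-- `U` prepares the quantum sample of `p`: `U|0⟩ = ∑ᵢ √pᵢ |i⟩`. -/
def IsQuantumSampleOracle {n : ℕ} [NeZero n] (p : Fin n → ℝ) (U : Matrix (Fin n) (Fin n) ℂ) :
    Prop :=
  U ∈ Matrix.unitaryGroup (Fin n) ℂ ∧ ∀ i, U i 0 = (√(p i) : ℂ)

/-- `U` is a purified access oracle of `p`: `U|0⟩|0⟩ = ∑ᵢ √pᵢ |ψᵢ⟩|i⟩` for some orthonormal family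
of vectors `ψᵢ`. -/
def IsPurifiedOracle {n : ℕ} [NeZero n] (p : Fin n → ℝ)
    (U : Matrix (Fin n × Fin n) (Fin n × Fin n) ℂ) : Prop :=
  U ∈ Matrix.unitaryGroup (Fin n × Fin n) ℂ ∧
    ∃ ψ : Fin n → EuclideanSpace ℂ (Fin n), Orthonormal ℂ ψ ∧
      ∀ a i, U (a, i) (0, 0) = (√(p i) : ℂ) * ψ i a

/-- With access to `p` in the given model, the algorithm returns a number in `S` with probability
at least `s`: for every oracle that represents `p`, and in the model of classically drawn samples
with respect to the joint randomness of the samples and of the final measurement. -/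
def Succeeds {n : ℕ} [NeZero n] : (M : InputModel) → QueryAlgorithm (M.Reg n) →
    (s : ℝ) → (p : Fin n → ℝ) → (S : Set ℝ) → Prop
  | .frequency m, A, s, p, S =>
      ∀ v : Fin m → Fin n, frequencies v = p → s ≤ A.outputProb (stringOracle v) S
  | .samples m, A, s, p, S =>
      s ≤ ∑ v : Fin m → Fin n, (∏ j, p (v j)) * A.outputProb (stringOracle v) S
  | .quantumSample, A, s, p, S =>
      ∀ U, IsQuantumSampleOracle p U → s ≤ A.outputProb U S
  | .purified, A, s, p, S =>
      ∀ U, IsPurifiedOracle p U → s ≤ A.outputProb U S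

/-- Some oracle of the model represents the distribution `p`.  This is a restriction only for
frequency vectors, where `p` has to be the frequency vector of a string of the given length. -/
def Represents {n : ℕ} : InputModel → (Fin n → ℝ) → Prop
  | .frequency m, p => ∃ v : Fin m → Fin n, frequencies v = p
  | .samples _, _ => True
  | .quantumSample, _ => True
  | .purified, _ => True

/-- The algorithm distinguishes `p` from `q` with success probability `s`: it answers `1` on `p`
and `0` on `q`. -/
def Distinguishes {n : ℕ} [NeZero n] (M : InputModel) (A : QueryAlgorithm (M.Reg n)) (s : ℝ)
    (p q : Fin n → ℝ) : Prop :=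
  M.Succeeds A s p {1} ∧ M.Succeeds A s q {0}

/-- The algorithm outputs, with probability at least `s`, a `γ`-multiplicative approximation of the
entropy, for every input distribution on `n` labels. -/
def EstimatesEntropy {n : ℕ} [NeZero n] (M : InputModel) (A : QueryAlgorithm (M.Reg n)) (s γ : ℝ) :
    Prop :=
  ∀ p ∈ stdSimplex ℝ (Fin n),
    M.Succeeds A s p (Set.Icc (shannonEntropy p / γ) (γ * shannonEntropy p))

end InputModel

end

noncomputable section

/-! The lower bound is the hybrid argument, in a form that allows a random oracle. Compare a run
with oracle `U i`, drawn with weight `w i`, to a run with a fixed oracle `V`. One query to `U i`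
instead of `V` perturbs the state of the `V`-run, which is independent of `i`. If the mean square of
this perturbation is at most δ² for every fixed unit vector, then T queries move the state by at
most Tδ in the mean (`sum_norm2_state_sub_le`), and outcome probabilities by at most 2Tδ. Disjoint
answer sets hit with probability s on both sides then force 2s - 1 ≤ 2Tδ
(`two_mul_sub_one_le_queries`).

Each model admits oracles for the hard pair with δ = 2√ε. For strings, `V` is the oracle of the zero
string; the random string is a uniformly random cyclic shift of a given one, or the sample itself,
so every single position is nonzero with probability ε. For state-preparing unitaries, `V` is the
identity, and one plane rotation with cosine √(1 - ε) prepares the hard distribution.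

Hence T ≥ (2s - 1) / (4√ε) in all models (`lower_bound`). A multiplicative estimator is a
distinguisher: zero entropy must be answered exactly by 0, positive entropy by a positive number.
Superpolynomial hardness follows by letting ε be a sufficiently small multiple of n^(-2k). -/

/-- The squared `ℓ²` norm of a complex vector. -/
def normSq2 {α : Type*} [Fintype α] (x : α → ℂ) : ℝ := ∑ a, ‖x a‖ ^ 2

/-- The `ℓ²` norm of a complex vector. -/
def norm2 {α : Type*} [Fintype α] (x : α → ℂ) : ℝ := √(normSq2 x)

/-! ### Euclidean norms and measurement statistics -/

section Norm

variable {α : Type*} [Fintype α]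

theorem normSq2_nonneg (x : α → ℂ) : 0 ≤ normSq2 x :=
  Finset.sum_nonneg fun _ _ => sq_nonneg _

theorem norm2_nonneg (x : α → ℂ) : 0 ≤ norm2 x := Real.sqrt_nonneg _

theorem norm2_sq (x : α → ℂ) : norm2 x ^ 2 = normSq2 x := Real.sq_sqrt (normSq2_nonneg x)

theorem norm2_eq_norm (x : α → ℂ) : norm2 x = ‖WithLp.toLp 2 x‖ := by
  rw [EuclideanSpace.norm_eq]; rfl

theorem norm2_add_le (x y : α → ℂ) : norm2 (x + y) ≤ norm2 x + norm2 y := by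
  simp only [norm2_eq_norm, WithLp.toLp_add]
  exact norm_add_le _ _

theorem normSq2_eq_dotProduct (x : α → ℂ) : (normSq2 x : ℂ) = star x ⬝ᵥ x := by
  simp only [normSq2, dotProduct, Pi.star_apply, Complex.ofReal_sum]
  refine Finset.sum_congr rfl fun a _ => ?_
  rw [RCLike.star_def, Complex.conj_mul']
  simp

theorem normSq2_mulVec (M : Matrix α α ℂ) (x : α → ℂ) :
    (normSq2 (M *ᵥ x) : ℂ) = star x ⬝ᵥ ((Mᴴ * M) *ᵥ x) := by
  rw [normSq2_eq_dotProduct, Matrix.star_mulVec, ← Matrix.mulVec_mulVec,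
    Matrix.dotProduct_mulVec (star x)]

theorem norm2_mulVec_of_mem_unitaryGroup [DecidableEq α] {M : Matrix α α ℂ}
    (hM : M ∈ Matrix.unitaryGroup α ℂ) (x : α → ℂ) : norm2 (M *ᵥ x) = norm2 x := by
  rw [Matrix.mem_unitaryGroup_iff', Matrix.star_eq_conjTranspose] at hM
  unfold norm2
  congr 1
  have h := normSq2_mulVec M x
  rw [hM, Matrix.one_mulVec, ← normSq2_eq_dotProduct] at h
  exact_mod_cast h

/-- Measurement statistics differ by at most twice the distance of the two states. -/
theorem sum_norm_sq_sub_le {x y : α → ℂ} (hx : norm2 x = 1) (hy : norm2 y = 1)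
    (s : α → Prop) [DecidablePred s] :
    (∑ a, if s a then ‖x a‖ ^ 2 else 0) ≤
      (∑ a, if s a then ‖y a‖ ^ 2 else 0) + 2 * norm2 (x - y) := by
  -- `P` projects to the accepted outcomes.
  let P : (α → ℂ) → α → ℂ := fun z a => if s a then z a else 0
  have hP : ∀ z, (∑ a, if s a then ‖z a‖ ^ 2 else 0) = norm2 (P z) ^ 2 := by
    intro z
    rw [norm2_sq]
    refine Finset.sum_congr rfl fun a _ => ?_
    by_cases h : s a <;> simp [P, h]
  have hle : ∀ z, norm2 (P z) ≤ norm2 z := by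
    intro z
    refine Real.sqrt_le_sqrt (Finset.sum_le_sum fun a _ => ?_)
    by_cases h : s a <;> simp [P, h]
  have hadd : P x = P y + P (x - y) := by
    ext a
    by_cases h : s a <;> simp [P, h]
  rw [hP, hP]
  have h1 := norm2_add_le (P y) (P (x - y))
  rw [← hadd] at h1
  have h2 := hle (x - y)
  have h3 := hle x
  have h4 := hle y
  have h5 := norm2_nonneg (P x)
  have h6 := norm2_nonneg (P y)
  have h7 := norm2_nonneg (x - y)
  rw [hx] at h3
  rw [hy] at h4
  -- With a = ‖Px‖ and b = ‖Py‖: a² - b² = (a - b)(a + b), where a - b ≤ ‖x - y‖ and a + b ≤ 2.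
  nlinarith

end Norm

/-! ### The hybrid argument for random oracles -/

namespace QueryMode

theorem op_mem_unitaryGroup {Q : Type} [Fintype Q] [DecidableEq Q] {U : Matrix Q Q ℂ}
    (hU : U ∈ Matrix.unitaryGroup Q ℂ) (μ : QueryMode) : μ.op U ∈ Matrix.unitaryGroup Q ℂ := by
  cases μ with
  | forward => exact hU
  | inverse => exact Unitary.star_mem hU
  | skip => exact one_mem _

end QueryMode

namespace QueryAlgorithm

variable {Q : Type} [Fintype Q] [DecidableEq Q] (A : QueryAlgorithm Q)

theorem queryMatrix_mem_unitaryGroup {U : Matrix Q Q ℂ} (hU : U ∈ Matrix.unitaryGroup Q ℂ)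
    (t : ℕ) : A.queryMatrix U t ∈ Matrix.unitaryGroup (Q × Fin A.workDim) ℂ := by
  rw [Matrix.mem_unitaryGroup_iff', Matrix.star_eq_conjTranspose, queryMatrix,
    Matrix.blockDiagonal_conjTranspose, ← Matrix.blockDiagonal_mul, ← Matrix.blockDiagonal_one]
  congr 1
  funext w
  exact Matrix.mem_unitaryGroup_iff'.1 (QueryMode.op_mem_unitaryGroup hU _)

theorem norm2_state {U : Matrix Q Q ℂ} (hU : U ∈ Matrix.unitaryGroup Q ℂ) (t : ℕ) :
    norm2 (A.state U t) = 1 := by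
  induction t with
  | zero =>
    rw [state, norm2_mulVec_of_mem_unitaryGroup (A.gate 0).2, norm2_eq_norm]
    exact (PiLp.norm_single 2 (fun _ => ℂ) A.start 1).trans (by simp)
  | succ t ih =>
    rw [state, norm2_mulVec_of_mem_unitaryGroup (A.gate _).2,
      norm2_mulVec_of_mem_unitaryGroup (A.queryMatrix_mem_unitaryGroup hU t), ih]

/-- A controlled query is block diagonal in the workspace basis, so the error splits into orthogonal
pieces. This reduces arbitrary control to uncontrolled queries on the oracle register alone. -/
theorem normSq2_queryMatrix_sub (U V : Matrix Q Q ℂ) (t : ℕ) (x : Q × Fin A.workDim → ℂ) :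
    normSq2 ((A.queryMatrix U t - A.queryMatrix V t) *ᵥ x) =
      ∑ w, normSq2 (((A.mode t w).op U - (A.mode t w).op V) *ᵥ fun q => x (q, w)) := by
  unfold normSq2 queryMatrix
  rw [← Matrix.blockDiagonal_sub, Fintype.sum_prod_type_right]
  refine Finset.sum_congr rfl fun w _ => Finset.sum_congr rfl fun q _ => ?_
  congr 2
  simp only [Matrix.mulVec, dotProduct, Fintype.sum_prod_type, Matrix.blockDiagonal_apply,
    ite_mul, zero_mul, Finset.sum_ite_eq, Finset.mem_univ, if_true, Pi.sub_apply]

/-- The hybrid argument: if in the mean over `i` a query to `U i` differs from a query to `V` by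
at most `δ`, then after `t` queries the states differ in the mean by at most `t * δ`. -/
theorem sum_norm2_state_sub_le {ι : Type*} [Fintype ι] {w : ι → ℝ} (hw : ∀ i, 0 ≤ w i)
    (hw1 : ∑ i, w i = 1) {U : ι → Matrix Q Q ℂ} {V : Matrix Q Q ℂ}
    (hU : ∀ i, U i ∈ Matrix.unitaryGroup Q ℂ) (hV : V ∈ Matrix.unitaryGroup Q ℂ)
    {δ : ℝ} (hδ : 0 ≤ δ)
    (h : ∀ (μ : QueryMode) (y : Q → ℂ),
      ∑ i, w i * normSq2 ((μ.op (U i) - μ.op V) *ᵥ y) ≤ δ ^ 2 * normSq2 y) (t : ℕ) :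
    ∑ i, w i * norm2 (A.state (U i) t - A.state V t) ≤ t * δ := by
  induction t with
  | zero => simp [state, norm2, normSq2]
  | succ t ih =>
    have step : ∀ i, norm2 (A.state (U i) (t + 1) - A.state V (t + 1)) ≤
        norm2 (A.state (U i) t - A.state V t) +
          norm2 ((A.queryMatrix (U i) t - A.queryMatrix V t) *ᵥ A.state V t) := by
      intro i
      -- The old error is propagated by a unitary, and the new error acts on the state of the
      -- `V`-run. As that state is the same for all `i`, the hypothesis on fixed vectors applies to
      -- it.
      have e : A.queryMatrix (U i) t *ᵥ A.state (U i) t - A.queryMatrix V t *ᵥ A.state V t =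
          A.queryMatrix (U i) t *ᵥ (A.state (U i) t - A.state V t) +
            (A.queryMatrix (U i) t - A.queryMatrix V t) *ᵥ A.state V t := by
        rw [Matrix.mulVec_sub, Matrix.sub_mulVec]; abel
      rw [state, state, ← Matrix.mulVec_sub, norm2_mulVec_of_mem_unitaryGroup (A.gate _).2, e]
      refine (norm2_add_le _ _).trans_eq ?_
      rw [norm2_mulVec_of_mem_unitaryGroup (A.queryMatrix_mem_unitaryGroup (hU i) t)]
    have mean : ∑ i, w i * norm2 ((A.queryMatrix (U i) t - A.queryMatrix V t) *ᵥ A.state V t)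
        ≤ δ := by
      -- Jensen: the square of the mean norm is at most the mean of the squared norms, which is what
      -- `h` controls.
      refine le_of_sq_le_sq ?_ hδ
      calc _ ≤ ∑ i, w i *
            norm2 ((A.queryMatrix (U i) t - A.queryMatrix V t) *ᵥ A.state V t) ^ 2 :=
            Real.pow_arith_mean_le_arith_mean_pow_of_even _ _ _ (fun i _ => hw i) hw1 even_two
        _ = ∑ v, ∑ i, w i * normSq2 (((A.mode t v).op (U i) - (A.mode t v).op V) *ᵥ
              fun q => A.state V t (q, v)) := by
            simp only [norm2_sq, normSq2_queryMatrix_sub, Finset.mul_sum]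
            exact Finset.sum_comm
        _ ≤ ∑ v, δ ^ 2 * normSq2 (fun q => A.state V t (q, v)) :=
            Finset.sum_le_sum fun v _ => h _ _
        _ = δ ^ 2 * norm2 (A.state V t) ^ 2 := by
            rw [norm2_sq, ← Finset.mul_sum]
            simp only [normSq2, Fintype.sum_prod_type_right]
        _ = δ ^ 2 := by rw [A.norm2_state hV]; ring
    calc _ ≤ ∑ i, (w i * norm2 (A.state (U i) t - A.state V t) +
          w i * norm2 ((A.queryMatrix (U i) t - A.queryMatrix V t) *ᵥ A.state V t)) :=
          Finset.sum_le_sum fun i _ => by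
            rw [← mul_add]; exact mul_le_mul_of_nonneg_left (step i) (hw i)
      _ ≤ t * δ + δ := by rw [Finset.sum_add_distrib]; exact add_le_add ih mean
      _ = _ := by push_cast; ring

theorem outputProb_add_le_one {V : Matrix Q Q ℂ} (hV : V ∈ Matrix.unitaryGroup Q ℂ)
    {S S' : Set ℝ} (hS : Disjoint S S') : A.outputProb V S + A.outputProb V S' ≤ 1 := by
  classical
  have h1 : ∑ x, ‖A.state V A.queries x‖ ^ 2 = 1 := by
    have := norm2_sq (A.state V A.queries)
    rw [A.norm2_state hV, one_pow] at this
    exact this.symm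
  rw [outputProb, outputProb, ← Finset.sum_add_distrib, ← h1]
  refine Finset.sum_le_sum fun x _ => ?_
  by_cases hx : A.output x ∈ S
  · simp [hx, Set.disjoint_left.1 hS hx]
  · by_cases hx' : A.output x ∈ S' <;> simp [hx, hx']

/-- An algorithm that tells a random oracle `U i` from `V` makes many queries, if in the mean a
query to `U i` differs little from a query to `V`. -/
theorem two_mul_sub_one_le_queries {ι : Type*} [Fintype ι] {w : ι → ℝ} (hw : ∀ i, 0 ≤ w i)
    (hw1 : ∑ i, w i = 1) {U : ι → Matrix Q Q ℂ} {V : Matrix Q Q ℂ}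
    (hU : ∀ i, U i ∈ Matrix.unitaryGroup Q ℂ) (hV : V ∈ Matrix.unitaryGroup Q ℂ)
    {δ : ℝ} (hδ : 0 ≤ δ)
    (h : ∀ (μ : QueryMode) (y : Q → ℂ),
      ∑ i, w i * normSq2 ((μ.op (U i) - μ.op V) *ᵥ y) ≤ δ ^ 2 * normSq2 y)
    {S S' : Set ℝ} (hS : Disjoint S S') {s : ℝ}
    (h1 : s ≤ ∑ i, w i * A.outputProb (U i) S) (h2 : s ≤ A.outputProb V S') :
    2 * s - 1 ≤ 2 * (A.queries * δ) := by
  classical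
  have h3 := A.outputProb_add_le_one hV hS
  have h4 := A.sum_norm2_state_sub_le hw hw1 hU hV hδ h A.queries
  have h5 : ∑ i, w i * A.outputProb (U i) S ≤
      ∑ i, w i * (A.outputProb V S + 2 * norm2 (A.state (U i) A.queries - A.state V A.queries)) :=
    Finset.sum_le_sum fun i _ => mul_le_mul_of_nonneg_left
      (sum_norm_sq_sub_le (A.norm2_state (hU i) _) (A.norm2_state hV _) _) (hw i)
  have h6 : ∑ i, w i *
      (A.outputProb V S + 2 * norm2 (A.state (U i) A.queries - A.state V A.queries)) =
      A.outputProb V S +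
        2 * ∑ i, w i * norm2 (A.state (U i) A.queries - A.state V A.queries) := by
    simp only [mul_add, Finset.sum_add_distrib, ← Finset.sum_mul, hw1, one_mul, Finset.mul_sum]
    congr 1
    exact Finset.sum_congr rfl fun i _ => by ring
  linarith

end QueryAlgorithm

theorem norm_sub_sq_le (a b : ℂ) : ‖a - b‖ ^ 2 ≤ 2 * (‖a‖ ^ 2 + ‖b‖ ^ 2) := by
  have h := norm_sub_le a b
  nlinarith [norm_nonneg (a - b), norm_nonneg a, norm_nonneg b, sq_nonneg (‖a‖ - ‖b‖)]

theorem norm_dotProduct_sq_le {α : Type*} [Fintype α] (x y : α → ℂ) : ‖star x ⬝ᵥ y‖ ^ 2 ≤ normSq2 x * normSq2 y := by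
  have h := norm_inner_le_norm (𝕜 := ℂ) (WithLp.toLp 2 x) (WithLp.toLp 2 y)
  rw [EuclideanSpace.inner_eq_star_dotProduct, dotProduct_comm, ← norm2_eq_norm,
    ← norm2_eq_norm] at h
  calc _ ≤ (norm2 x * norm2 y) ^ 2 := pow_le_pow_left₀ (norm_nonneg _) h 2
    _ = _ := by rw [mul_pow, norm2_sq, norm2_sq]

/-! ### Queries to random strings -/

section StringOracle

variable {m n : ℕ}

theorem stringOracle_mulVec [NeZero n] (v : Fin m → Fin n) (y : Fin m × Fin n → ℂ) :
    stringOracle v *ᵥ y = fun x => y (x.1, x.2 - v x.1) := by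
  ext ⟨j, b⟩
  simp only [stringOracle, Matrix.mulVec, dotProduct, Matrix.of_apply, ite_mul, one_mul, zero_mul]
  rw [Finset.sum_eq_single (j, b - v j)]
  · simp
  · rintro ⟨j', b'⟩ - hne
    rw [if_neg]
    intro h
    obtain ⟨rfl, rfl⟩ := Prod.mk.inj h
    simp at hne
  · simp

theorem conjTranspose_stringOracle_mulVec (v : Fin m → Fin n) (y : Fin m × Fin n → ℂ) :
    (stringOracle v)ᴴ *ᵥ y = fun x => y (x.1, x.2 + v x.1) := by
  ext ⟨j, b⟩
  simp only [stringOracle, Matrix.mulVec, dotProduct, Matrix.conjTranspose_apply, Matrix.of_apply,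
    apply_ite star, star_one, star_zero, ite_mul, one_mul, zero_mul, Finset.sum_ite_eq',
    Finset.mem_univ, if_true]

/-- A query to a string acts on the label register by a shift, which is trivial where the string
is. -/
theorem exists_op_stringOracle_mulVec [NeZero n] (v : Fin m → Fin n) (μ : QueryMode) :
    ∃ g : Fin m → Fin n, (∀ j, v j = 0 → g j = 0) ∧
      ∀ y, μ.op (stringOracle v) *ᵥ y = fun x => y (x.1, x.2 + g x.1) := by
  cases μ with
  | forward =>
    refine ⟨fun j => -v j, fun j hj => by simp [hj], fun y => ?_⟩
    simp only [QueryMode.op, stringOracle_mulVec, sub_eq_add_neg]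
  | inverse => exact ⟨v, fun j => id, conjTranspose_stringOracle_mulVec v⟩
  | skip => exact ⟨0, fun j _ => rfl, fun y => by simp [QueryMode.op]⟩

/-- Positions with label 0 contribute nothing. At any other position the difference is a shifted
block minus the original block; both have the same norm, whence the factor 4. -/
theorem normSq2_op_stringOracle_sub_le [NeZero n] (v : Fin m → Fin n) (μ : QueryMode)
    (y : Fin m × Fin n → ℂ) :
    normSq2 ((μ.op (stringOracle v) - μ.op (stringOracle 0)) *ᵥ y) ≤
      ∑ j, (if v j = 0 then 0 else 1) * (4 * ∑ b, ‖y (j, b)‖ ^ 2) := by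
  obtain ⟨g, hg, hgv⟩ := exists_op_stringOracle_mulVec v μ
  obtain ⟨g', hg', hgv'⟩ := exists_op_stringOracle_mulVec (0 : Fin m → Fin n) μ
  rw [Matrix.sub_mulVec, hgv, hgv', normSq2, Fintype.sum_prod_type]
  refine Finset.sum_le_sum fun j _ => ?_
  simp only [Pi.sub_apply, hg' _ rfl, add_zero]
  by_cases hj : v j = 0
  · simp [hj, hg j hj]
  · have hshift : ∑ b, ‖y (j, b + g j)‖ ^ 2 = ∑ b, ‖y (j, b)‖ ^ 2 :=
      Equiv.sum_comp (Equiv.addRight (g j)) fun b => ‖y (j, b)‖ ^ 2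
    rw [if_neg hj, one_mul]
    calc _ ≤ ∑ b, 2 * (‖y (j, b + g j)‖ ^ 2 + ‖y (j, b)‖ ^ 2) :=
          Finset.sum_le_sum fun b _ => norm_sub_sq_le _ _
      _ = _ := by rw [← Finset.mul_sum, Finset.sum_add_distrib, hshift]; ring

/-- If every entry of a random string is nonzero with probability at most `ε`, then a query to it
differs in the mean little from a query to the zero string. -/
theorem sum_normSq2_op_stringOracle_sub_le [NeZero n] {ι : Type*} [Fintype ι] {w : ι → ℝ}
    (hw : ∀ i, 0 ≤ w i) {v : ι → Fin m → Fin n} {ε : ℝ} (hε : 0 ≤ ε)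
    (h : ∀ j, ∑ i, w i * (if v i j = 0 then 0 else 1) ≤ ε) (μ : QueryMode)
    (y : Fin m × Fin n → ℂ) :
    ∑ i, w i * normSq2 ((μ.op (stringOracle (v i)) - μ.op (stringOracle 0)) *ᵥ y) ≤
      (2 * √ε) ^ 2 * normSq2 y := by
  calc _ ≤ ∑ i, w i * ∑ j, (if v i j = 0 then 0 else 1) * (4 * ∑ b, ‖y (j, b)‖ ^ 2) :=
        Finset.sum_le_sum fun i _ =>
          mul_le_mul_of_nonneg_left (normSq2_op_stringOracle_sub_le _ _ _) (hw i)
    -- Averaging before summing over positions leaves, at each `j`, only the probability that the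
    -- entry there is nonzero.
    _ = ∑ j, (∑ i, w i * (if v i j = 0 then 0 else 1)) * (4 * ∑ b, ‖y (j, b)‖ ^ 2) := by
        rw [Finset.sum_congr rfl fun i _ => Finset.mul_sum _ _ _, Finset.sum_comm]
        refine Finset.sum_congr rfl fun j _ => ?_
        rw [Finset.sum_mul]
        exact Finset.sum_congr rfl fun i _ => (mul_assoc _ _ _).symm
    _ ≤ ∑ j, ε * (4 * ∑ b, ‖y (j, b)‖ ^ 2) :=
        Finset.sum_le_sum fun j _ => mul_le_mul_of_nonneg_right (h j) (by positivity)
    _ = _ := by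
        rw [mul_pow, Real.sq_sqrt hε, normSq2, Fintype.sum_prod_type, Finset.mul_sum]
        exact Finset.sum_congr rfl fun j _ => by ring

/-- In a string with independent entries, every single entry has the given distribution. -/
theorem sum_prod_mul_apply {p : Fin n → ℝ} (hp : ∑ b, p b = 1) (g : Fin n → ℝ) (j : Fin m) :
    ∑ v : Fin m → Fin n, (∏ k, p (v k)) * g (v j) = ∑ b, p b * g b := by
  -- Expanding this product of sums gives the left-hand side; every factor other than the `j`-th
  -- equals the total mass 1.
  have h := Finset.prod_univ_sum (fun _ : Fin m => (Finset.univ : Finset (Fin n)))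
    (fun k b => p b * if k = j then g b else 1)
  simp only [Finset.prod_mul_distrib, Finset.prod_ite_eq', Finset.mem_univ, if_true,
    Fintype.piFinset_univ] at h
  rw [← h, Finset.prod_eq_single j]
  · simp
  · intro k _ hk
    simp [hk, hp]
  · simp

theorem sum_prod_eq_one {p : Fin n → ℝ} (hp : ∑ b, p b = 1) :
    ∑ v : Fin m → Fin n, ∏ k, p (v k) = 1 := by
  have h := Finset.prod_univ_sum (fun _ : Fin m => (Finset.univ : Finset (Fin n))) (fun _ b => p b)
  rw [Fintype.piFinset_univ] at h
  simp [← h, hp]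

end StringOracle

/-! ### Plane rotations as oracles -/

section Rotation

variable {Q : Type} [Fintype Q]

/-- The projection to the plane spanned by two real orthonormal vectors. -/
def planeProj (e f : Q → ℂ) : Matrix Q Q ℂ := Matrix.vecMulVec e e + Matrix.vecMulVec f f

/-- The quarter turn, from `e` to `f`, of the plane spanned by two real orthonormal vectors. -/
def planeTurn (e f : Q → ℂ) : Matrix Q Q ℂ := Matrix.vecMulVec f e - Matrix.vecMulVec e f

/-- The rotation with cosine `c` and sine `s` of the plane spanned by two real orthonormal
vectors. -/
def planeRotation [DecidableEq Q] (e f : Q → ℂ) (c s : ℝ) : Matrix Q Q ℂ :=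
  1 + (((c - 1 : ℝ) : ℂ) • planeProj e f + (s : ℂ) • planeTurn e f)

/-- The vectors `e` and `f` are real, and they are orthonormal. -/
structure IsRealOrthonormal (e f : Q → ℂ) : Prop where
  star_left : star e = e
  star_right : star f = f
  left_left : e ⬝ᵥ e = 1
  right_right : f ⬝ᵥ f = 1
  left_right : e ⬝ᵥ f = 0

variable {e f : Q → ℂ}

theorem conjTranspose_planeProj (h : IsRealOrthonormal e f) : (planeProj e f)ᴴ = planeProj e f := by
  simp [planeProj, Matrix.conjTranspose_vecMulVec, h.star_left, h.star_right]

theorem conjTranspose_planeTurn (h : IsRealOrthonormal e f) : (planeTurn e f)ᴴ = -planeTurn e f := by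
  simp [planeTurn, Matrix.conjTranspose_vecMulVec, h.star_left, h.star_right]

/-- On the plane the projection P acts as 1 and the quarter turn J as the imaginary unit, so cP + sJ
multiplies like the complex number c + is. -/
theorem planeProj_planeTurn_mul (h : IsRealOrthonormal e f) :
    planeProj e f * planeProj e f = planeProj e f ∧ planeProj e f * planeTurn e f = planeTurn e f ∧
      planeTurn e f * planeProj e f = planeTurn e f ∧
      planeTurn e f * planeTurn e f = -planeProj e f := by
  have hfe : f ⬝ᵥ e = 0 := by rw [dotProduct_comm, h.left_right]
  refine ⟨?_, ?_, ?_, ?_⟩ <;>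
  · simp only [planeProj, planeTurn, mul_add, add_mul, mul_sub, sub_mul,
      Matrix.vecMulVec_mul_vecMulVec, h.left_left, h.right_right, h.left_right, hfe, zero_smul, one_smul,
      Matrix.vecMulVec_zero]
    abel

theorem conjTranspose_planeRotation [DecidableEq Q] (h : IsRealOrthonormal e f) (c s : ℝ) :
    (planeRotation e f c s)ᴴ = planeRotation e f c (-s) := by
  simp [planeRotation, conjTranspose_planeProj h, conjTranspose_planeTurn h,
    Matrix.conjTranspose_smul]

/-- The product is ((c - 1)² + s²)P, the analogue of |c + is - 1|². -/
theorem conjTranspose_mul_planeRotation_sub_one [DecidableEq Q] (h : IsRealOrthonormal e f) {c s : ℝ}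
    (hcs : c ^ 2 + s ^ 2 = 1) :
    (planeRotation e f c s - 1)ᴴ * (planeRotation e f c s - 1) =
      ((2 - 2 * c : ℝ) : ℂ) • planeProj e f := by
  obtain ⟨h1, h2, h3, h4⟩ := planeProj_planeTurn_mul h
  rw [Matrix.conjTranspose_sub, conjTranspose_planeRotation h, Matrix.conjTranspose_one]
  simp only [planeRotation, add_sub_cancel_left, mul_add, add_mul, Matrix.smul_mul,
    Matrix.mul_smul, h1, h2, h3, h4, smul_neg, smul_smul]
  match_scalars
  · have h' : (c : ℂ) ^ 2 + (s : ℂ) ^ 2 = 1 := by exact_mod_cast hcs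
    linear_combination h'
  · ring

theorem planeRotation_mem_unitaryGroup [DecidableEq Q] (h : IsRealOrthonormal e f) {c s : ℝ}
    (hcs : c ^ 2 + s ^ 2 = 1) :
    planeRotation e f c s ∈ Matrix.unitaryGroup Q ℂ := by
  obtain ⟨h1, h2, h3, h4⟩ := planeProj_planeTurn_mul h
  rw [Matrix.mem_unitaryGroup_iff', Matrix.star_eq_conjTranspose,
    conjTranspose_planeRotation h]
  simp only [planeRotation, mul_add, add_mul, Matrix.smul_mul, one_mul, mul_one,
    Matrix.mul_smul, h1, h2, h3, h4, smul_neg, smul_smul]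
  have h' : (c : ℂ) ^ 2 + (s : ℂ) ^ 2 = 1 := by exact_mod_cast hcs
  match_scalars
  · ring
  · linear_combination h'
  · ring

/-- The left side is (2 - 2c) times the squared norm of the projection of `y` to the plane.
Cauchy–Schwarz for `e` and `f` separately bounds the latter by twice `normSq2 y`; Bessel's
inequality would save this factor 2. -/
theorem normSq2_planeRotation_sub_one_mulVec_le [DecidableEq Q] (h : IsRealOrthonormal e f) {c s : ℝ}
    (hcs : c ^ 2 + s ^ 2 = 1) (y : Q → ℂ) :
    normSq2 ((planeRotation e f c s - 1) *ᵥ y) ≤ 4 * (1 - c) * normSq2 y := by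
  have hc : c ≤ 1 := by nlinarith [sq_nonneg s]
  have key : ∀ g : Q → ℂ, star g = g → g ⬝ᵥ g = 1 →
      ‖star y ⬝ᵥ g‖ ^ 2 ≤ normSq2 y ∧
        star y ⬝ᵥ (Matrix.vecMulVec g g *ᵥ y) = ((‖star y ⬝ᵥ g‖ ^ 2 : ℝ) : ℂ) := by
    intro g hg hgg
    have h1 : normSq2 g = 1 := by
      have := normSq2_eq_dotProduct g
      rw [hg, hgg] at this
      exact_mod_cast this
    refine ⟨by simpa [h1] using norm_dotProduct_sq_le y g, ?_⟩
    have h2 : star (star y ⬝ᵥ g) = g ⬝ᵥ y := by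
      rw [Matrix.star_dotProduct, star_star, dotProduct_comm, hg, dotProduct_comm]
    rw [Matrix.vecMulVec_mulVec, ← h2, dotProduct_smul, MulOpposite.smul_eq_mul_unop,
      MulOpposite.unop_op]
    rw [RCLike.star_def, Complex.mul_conj']
    simp
  obtain ⟨e1, e2⟩ := key e h.star_left h.left_left
  obtain ⟨f1, f2⟩ := key f h.star_right h.right_right
  have h3 := normSq2_mulVec (planeRotation e f c s - 1) y
  rw [conjTranspose_mul_planeRotation_sub_one h hcs, planeProj, Matrix.smul_mulVec,
    Matrix.add_mulVec, dotProduct_smul, dotProduct_add, e2, f2, smul_eq_mul, ← Complex.ofReal_add,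
    ← Complex.ofReal_mul, Complex.ofReal_inj] at h3
  rw [h3]
  nlinarith

theorem normSq2_op_planeRotation_sub_le [DecidableEq Q] (h : IsRealOrthonormal e f) {c s : ℝ}
    (hcs : c ^ 2 + s ^ 2 = 1) (μ : QueryMode)
    (y : Q → ℂ) :
    normSq2 ((μ.op (planeRotation e f c s) - μ.op 1) *ᵥ y) ≤ 4 * (1 - c) * normSq2 y := by
  have hc : c ≤ 1 := by nlinarith [sq_nonneg s]
  cases μ with
  | forward => exact normSq2_planeRotation_sub_one_mulVec_le h hcs y
  | inverse =>
    simp only [QueryMode.op, conjTranspose_planeRotation h, Matrix.conjTranspose_one]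
    exact normSq2_planeRotation_sub_one_mulVec_le h (by simpa using hcs) y
  | skip =>
    have h0 := normSq2_nonneg y
    have h1 : 0 ≤ 1 - c := by linarith
    simp only [QueryMode.op, sub_self, Matrix.zero_mulVec]
    simp only [normSq2, Pi.zero_apply, norm_zero] at h0 ⊢
    simp only [ne_eq, OfNat.ofNat_ne_zero, not_false_eq_true, zero_pow, Finset.sum_const_zero]
    positivity

theorem planeRotation_mulVec [DecidableEq Q] (h : IsRealOrthonormal e f) (c s : ℝ) :
    planeRotation e f c s *ᵥ e = (c : ℂ) • e + (s : ℂ) • f := by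
  have hfe : f ⬝ᵥ e = 0 := by rw [dotProduct_comm, h.left_right]
  simp only [planeRotation, planeProj, planeTurn, Matrix.add_mulVec, Matrix.sub_mulVec,
    Matrix.smul_mulVec, Matrix.one_mulVec, Matrix.vecMulVec_mulVec, h.left_left, hfe]
  simp only [MulOpposite.op_one, one_smul, MulOpposite.op_zero, zero_smul, add_zero, sub_zero]
  push_cast
  module

end Rotation

/-! ### The hard pair: entropy, Hellinger distance, representing strings -/

section HardPair

variable {n : ℕ} [NeZero n] {ε : ℝ}

/-- Taken with `id` this gives the total mass, and with x log x the entropy. -/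
theorem sum_hardDist_comp (g : ℝ → ℝ) :
    ∑ i, g (hardDist n ε i) = g (1 - ε) + ((n : ℝ) - 1) * g (ε / ((n : ℝ) - 1)) := by
  have h : ∀ i, i ∈ Finset.univ.erase (0 : Fin n) →
      g (hardDist n ε i) = g (ε / ((n : ℝ) - 1)) := fun i hi => by
    rw [hardDist, if_neg (Finset.ne_of_mem_erase hi)]
  rw [← Finset.add_sum_erase _ _ (Finset.mem_univ (0 : Fin n)), Finset.sum_congr rfl h,
    Finset.sum_const, Finset.card_erase_of_mem (Finset.mem_univ _), Finset.card_univ,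
    Fintype.card_fin, nsmul_eq_mul, Nat.cast_sub NeZero.one_le]
  simp [hardDist]

theorem hardDist_mem_stdSimplex (hn : 2 ≤ n) (h0 : 0 ≤ ε) (h1 : ε ≤ 1) :
    hardDist n ε ∈ stdSimplex ℝ (Fin n) := by
  have hn' : (2 : ℝ) ≤ n := by exact_mod_cast hn
  have hn1 : (0 : ℝ) < n - 1 := by linarith
  refine ⟨fun i => ?_, ?_⟩
  · unfold hardDist
    split_ifs
    · linarith
    · positivity
  · refine (sum_hardDist_comp id).trans ?_
    simp only [id]
    field_simp
    ring

theorem pointMass_mem_stdSimplex : pointMass n ∈ stdSimplex ℝ (Fin n) :=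
  single_mem_stdSimplex ℝ 0

theorem shannonEntropy_pointMass : shannonEntropy (pointMass n) = 0 := by
  rw [shannonEntropy, neg_eq_zero]
  refine Finset.sum_eq_zero fun i _ => ?_
  by_cases h : i = 0 <;> simp [pointMass, h]

theorem hellingerDist_hardDist (hn : 2 ≤ n) (h0 : 0 ≤ ε) (h1 : ε ≤ 1) :
    hellingerDist (hardDist n ε) (pointMass n) = √(1 - √(1 - ε)) := by
  have hn' : (2 : ℝ) ≤ n := by exact_mod_cast hn
  have hn1 : (0 : ℝ) < n - 1 := by linarith
  have hs := Real.sq_sqrt (sub_nonneg.2 h1)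
  have e : ∀ i, (√(hardDist n ε i) - √(pointMass n i)) ^ 2 =
      hardDist n ε i + (if i = 0 then 1 - 2 * √(1 - ε) else 0) := by
    intro i
    by_cases h : i = 0
    · subst h
      simp only [hardDist, pointMass, if_true, Pi.single_eq_same, Real.sqrt_one]
      linear_combination hs
    · have := Real.sq_sqrt (div_nonneg h0 hn1.le)
      simp [hardDist, pointMass, h, this]
  rw [hellingerDist, Finset.sum_congr rfl fun i _ => e i, Finset.sum_add_distrib,
    (hardDist_mem_stdSimplex hn h0 h1).2, Finset.sum_ite_eq' _ _ _]
  simp only [Finset.mem_univ, if_true]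
  congr 1
  ring

theorem one_sub_sqrt_one_sub_le (h0 : 0 ≤ ε) (h1 : ε ≤ 1) : 1 - √(1 - ε) ≤ ε := by
  have hs := Real.sq_sqrt (sub_nonneg.2 h1)
  nlinarith [Real.sqrt_nonneg (1 - ε), sq_nonneg (1 - √(1 - ε))]

theorem half_le_one_sub_sqrt_one_sub (h1 : ε ≤ 1) : ε / 2 ≤ 1 - √(1 - ε) := by
  have hs := Real.sq_sqrt (sub_nonneg.2 h1)
  nlinarith [sq_nonneg (1 - √(1 - ε))]

theorem shannonEntropy_hardDist (hn : 2 ≤ n) :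
    shannonEntropy (hardDist n ε) =
      -(1 - ε) * Real.logb 2 (1 - ε) - ε * Real.logb 2 ε + ε * Real.logb 2 ((n : ℝ) - 1) := by
  have hn' : (2 : ℝ) ≤ n := by exact_mod_cast hn
  have hn1 : (n : ℝ) - 1 ≠ 0 := by linarith
  rw [shannonEntropy, sum_hardDist_comp fun x => x * Real.logb 2 x]
  by_cases h : ε = 0
  · simp [h]
  · rw [Real.logb_div h hn1]
    field_simp
    ring

theorem mul_logb_nonpos {x : ℝ} (h0 : 0 ≤ x) (h1 : x ≤ 1) : x * Real.logb 2 x ≤ 0 :=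
  mul_nonpos_of_nonneg_of_nonpos h0 (Real.logb_nonpos (by norm_num) h0 h1)

theorem mul_logb_neg {x : ℝ} (h0 : 0 < x) (h1 : x < 1) : x * Real.logb 2 x < 0 :=
  mul_neg_of_pos_of_neg h0 (Real.logb_neg (by norm_num) h0 h1)

theorem shannonEntropy_hardDist_pos (hn : 2 ≤ n) (h0 : 0 < ε) (h1 : ε < 1) :
    0 < shannonEntropy (hardDist n ε) := by
  have hn' : (2 : ℝ) ≤ n := by exact_mod_cast hn
  rw [shannonEntropy_hardDist hn]
  have h2 := mul_logb_neg h0 h1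
  have h3 := mul_logb_neg (sub_pos.2 h1) (by linarith)
  have h4 : 0 ≤ ε * Real.logb 2 ((n : ℝ) - 1) :=
    mul_nonneg h0.le (Real.logb_nonneg (by norm_num) (by linarith))
  linarith

/-- From n ≤ 2(n - 1), passing from log n to log (n - 1) costs at most one bit; the term -ε log ε ≥
ε pays for it, as ε ≤ 1/2. -/
theorem mul_logb_le_shannonEntropy_hardDist (hn : 2 ≤ n) (h0 : 0 ≤ ε) (h1 : ε ≤ 1 / 2) :
    ε * Real.logb 2 n ≤ shannonEntropy (hardDist n ε) := by
  have hn' : (2 : ℝ) ≤ n := by exact_mod_cast hn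
  have hn1 : (0 : ℝ) < n - 1 := by linarith
  rw [shannonEntropy_hardDist hn]
  have h2 := mul_logb_nonpos (x := 1 - ε) (by linarith) (by linarith)
  have h3 : Real.logb 2 n ≤ 1 + Real.logb 2 ((n : ℝ) - 1) := by
    have h5 := Real.logb_mul (b := 2) two_ne_zero hn1.ne'
    rw [Real.logb_self_eq_one (by norm_num)] at h5
    rw [← h5]
    exact Real.logb_le_logb_of_le (by norm_num) (by linarith) (by linarith)
  have h4 : ε * Real.logb 2 ε ≤ -ε := by
    rcases h0.eq_or_lt with rfl | h0
    · simp
    · have h5 : Real.logb 2 ε ≤ Real.logb 2 (1 / 2) :=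
        Real.logb_le_logb_of_le (by norm_num) h0 h1
      rw [one_div, Real.logb_inv, Real.logb_self_eq_one (by norm_num)] at h5
      nlinarith
  nlinarith

/-- Since n ≤ (n - 1)² for n ≥ 3, the term ε log (n - 1) alone suffices. -/
theorem half_mul_logb_le_shannonEntropy_hardDist (hn : 3 ≤ n) (h0 : 0 ≤ ε) (h1 : ε ≤ 1) :
    ε / 2 * Real.logb 2 n ≤ shannonEntropy (hardDist n ε) := by
  have hn' : (3 : ℝ) ≤ n := by exact_mod_cast hn
  rw [shannonEntropy_hardDist (by omega)]
  have h2 := mul_logb_nonpos (x := 1 - ε) (by linarith) (by linarith)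
  have h3 := mul_logb_nonpos h0 h1
  have h4 : Real.logb 2 n ≤ 2 * Real.logb 2 ((n : ℝ) - 1) := by
    rw [← Nat.cast_ofNat (R := ℝ), ← Real.logb_pow]
    exact Real.logb_le_logb_of_le (by norm_num) (by linarith) (by nlinarith)
  nlinarith

/-- The string with labels `0, 1, …, n - 1, 0, 0, …` has the frequency vector `hardDist n ε` with
`ε = (n - 1) / m`. -/
theorem exists_frequencies_eq_hardDist {m : ℕ} (hnm : n ≤ m) (hn : 2 ≤ n) :
    ∃ v : Fin m → Fin n, frequencies v = hardDist n (((n : ℝ) - 1) / m) := by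
  have hn' : (2 : ℝ) ≤ n := by exact_mod_cast hn
  have hn1 : (n : ℝ) - 1 ≠ 0 := by linarith
  have hm : (m : ℝ) ≠ 0 := by
    have : m ≠ 0 := by omega
    exact_mod_cast this
  let v : Fin m → Fin n := fun j => if h : (j : ℕ) < n then ⟨j, h⟩ else 0
  have h1 : ∀ i : Fin n, i ≠ 0 → (Finset.univ.filter fun j => v j = i).card = 1 := by
    intro i hi
    rw [Finset.card_eq_one]
    refine ⟨⟨i, i.2.trans_le hnm⟩, ?_⟩
    ext j
    simp only [Finset.mem_filter, Finset.mem_univ, true_and, Finset.mem_singleton, v, Fin.ext_iff]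
    split_ifs with h
    · rfl
    · have : (i : ℕ) ≠ 0 := fun h => hi (Fin.ext h)
      have h0 : ((0 : Fin n) : ℕ) = 0 := rfl
      omega
  have h2 : ∑ i, (Finset.univ.filter fun j => v j = i).card = m := by
    rw [← Finset.card_eq_sum_card_fiberwise fun _ _ => Finset.mem_coe.2 (Finset.mem_univ _)]
    simp
  rw [← Finset.add_sum_erase _ _ (Finset.mem_univ (0 : Fin n)),
    Finset.sum_congr rfl fun i hi => h1 i (Finset.ne_of_mem_erase hi), Finset.sum_const,
    Finset.card_erase_of_mem (Finset.mem_univ _), Finset.card_univ, Fintype.card_fin] at h2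
  refine ⟨v, funext fun i => ?_⟩
  by_cases hi : i = 0
  · subst hi
    have h3 : ((Finset.univ.filter fun j => v j = 0).card : ℝ) = m - (n - 1) := by
      rw [smul_eq_mul, mul_one] at h2
      have : (Finset.univ.filter fun j => v j = 0).card + n = m + 1 := by omega
      have : ((Finset.univ.filter fun j => v j = 0).card : ℝ) + n = m + 1 := by exact_mod_cast this
      linarith
    simp only [frequencies, hardDist, if_true, h3]
    field_simp
  · simp only [frequencies, hardDist, if_neg hi, h1 i hi]
    field_simp
    simp

end HardPair

/-! ### Lower bounds in the four input models -/

namespace InputModel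

variable {n : ℕ} [NeZero n] {ε : ℝ}

theorem frequencies_zero {m : ℕ} (hm : m ≠ 0) :
    frequencies (0 : Fin m → Fin n) = pointMass n := by
  have hm' : (m : ℝ) ≠ 0 := by exact_mod_cast hm
  ext i
  by_cases h : i = 0
  · subst h; simp [frequencies, pointMass, hm']
  · simp [frequencies, pointMass, h, Ne.symm h]

/-- A single string would not do, because an algorithm may know a position where it is nonzero. All
cyclic shifts of `u` have the same frequencies, and under a uniformly random shift each position is
nonzero with probability exactly ε. -/
theorem frequency_lower_bound (hε : 0 < ε) {m : ℕ} {u : Fin m → Fin n}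
    (hu : frequencies u = hardDist n ε) (A : QueryAlgorithm (Fin m × Fin n)) {s : ℝ}
    {S S' : Set ℝ} (hS : Disjoint S S') (h1 : (frequency m).Succeeds A s (hardDist n ε) S)
    (h2 : (frequency m).Succeeds A s (pointMass n) S') :
    2 * s - 1 ≤ 2 * (A.queries * (2 * √ε)) := by
  -- An empty query register has no initial basis state.
  have hm : m ≠ 0 := by
    rintro rfl
    exact A.start.1.1.elim0
  have : NeZero m := ⟨hm⟩
  have hm' : (m : ℝ) ≠ 0 := by exact_mod_cast hm
  have hcount : ∑ j, (if u j = 0 then (0 : ℝ) else 1) = m * ε := by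
    have h := congrFun hu 0
    simp only [frequencies, hardDist, if_true] at h
    have h' : ∑ j, (if u j = 0 then (0 : ℝ) else 1) + ∑ j, (if u j = 0 then (1 : ℝ) else 0) = m := by
      rw [← Finset.sum_add_distrib, Finset.sum_congr rfl fun j _ =>
        show (if u j = 0 then (0 : ℝ) else 1) + (if u j = 0 then 1 else 0) = 1 by
          split_ifs <;> norm_num]
      simp
    rw [Finset.sum_boole] at h'
    field_simp at h
    linarith
  have hshift : ∀ (g : Fin n → ℝ) (j : Fin m), ∑ i, g (u (j + i)) = ∑ i, g (u i) := fun g j =>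
    Equiv.sum_comp (Equiv.addLeft j) fun i => g (u i)
  have hshift' : ∀ (g : Fin n → ℝ) (j : Fin m), ∑ i, g (u (i + j)) = ∑ i, g (u i) := fun g j =>
    Equiv.sum_comp (Equiv.addRight j) fun i => g (u i)
  have hw1 : ∑ _i : Fin m, (m : ℝ)⁻¹ = 1 := by simp [hm']
  refine A.two_mul_sub_one_le_queries (w := fun _ : Fin m => (m : ℝ)⁻¹)
    (U := fun i => stringOracle fun j => u (j + i)) (V := stringOracle 0)
    (fun _ => by positivity) hw1 (fun _ => stringOracle_mem_unitaryGroup _)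
    (stringOracle_mem_unitaryGroup _) (by positivity)
    (sum_normSq2_op_stringOracle_sub_le (fun _ => by positivity) hε.le fun j => ?_) hS ?_
    (h2 _ (frequencies_zero hm))
  · rw [← Finset.mul_sum, hshift (fun b => if b = 0 then 0 else 1), hcount]
    field_simp
    rfl
  · have hfreq : ∀ i, frequencies (fun j => u (j + i)) = hardDist n ε := by
      intro i
      rw [← hu]
      ext b
      simp only [frequencies]
      congr 1
      simp only [← Finset.sum_boole]
      exact hshift' (fun b' => if b' = b then 1 else 0) i
    calc s = ∑ _i : Fin m, (m : ℝ)⁻¹ * s := by rw [← Finset.sum_mul, hw1, one_mul]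
      _ ≤ _ := Finset.sum_le_sum fun i _ =>
          mul_le_mul_of_nonneg_left (h1 _ (hfreq i)) (by positivity)

theorem samples_lower_bound (hn : 2 ≤ n) (hε : 0 < ε) (hε1 : ε ≤ 1) {m : ℕ}
    (A : QueryAlgorithm (Fin m × Fin n)) {s : ℝ}
    {S S' : Set ℝ} (hS : Disjoint S S') (h1 : (samples m).Succeeds A s (hardDist n ε) S)
    (h2 : (samples m).Succeeds A s (pointMass n) S') :
    2 * s - 1 ≤ 2 * (A.queries * (2 * √ε)) := by
  obtain ⟨hp, hp1⟩ := hardDist_mem_stdSimplex hn hε.le hε1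
  have hw : ∀ v : Fin m → Fin n, 0 ≤ ∏ j, hardDist n ε (v j) := fun v =>
    Finset.prod_nonneg fun j _ => hp _
  have hsum : ∑ b, hardDist n ε b * (if b = 0 then 0 else 1) = ε := by
    have e : ∀ b, hardDist n ε b * (if b = 0 then 0 else 1) =
        hardDist n ε b - if b = 0 then 1 - ε else 0 := by
      intro b
      by_cases h : b = 0 <;> simp [h, hardDist]
    rw [Finset.sum_congr rfl fun b _ => e b, Finset.sum_sub_distrib, hp1, Finset.sum_ite_eq']
    simp
  refine A.two_mul_sub_one_le_queries (U := fun v => stringOracle v) (V := stringOracle 0)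
    hw (sum_prod_eq_one hp1) (fun _ => stringOracle_mem_unitaryGroup _)
    (stringOracle_mem_unitaryGroup _) (by positivity)
    (sum_normSq2_op_stringOracle_sub_le hw hε.le fun j => ?_) hS h1 ?_
  · rw [sum_prod_mul_apply hp1 (fun b => if b = 0 then 0 else 1), hsum]
  · refine h2.trans_eq ?_
    -- Samples from the point mass form the zero string almost surely.
    rw [Finset.sum_eq_single 0]
    · simp [pointMass]
    · intro v _ hv
      obtain ⟨j, hj⟩ := Function.ne_iff.1 hv
      rw [Finset.prod_eq_zero (Finset.mem_univ j), zero_mul]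
      simpa [pointMass, Pi.single_apply] using hj
    · simp

/-- The lower bound for unitary oracles that may rotate `e` to `√(1 - ε) e + √ε f` on one input and
may be trivial on the other. -/
theorem rotation_lower_bound {Q : Type} [Fintype Q] [DecidableEq Q] (hε : 0 < ε) (hε1 : ε ≤ 1)
    {e f : Q → ℂ} (h : IsRealOrthonormal e f) (A : QueryAlgorithm Q) {s : ℝ}
    {S S' : Set ℝ} (hS : Disjoint S S')
    (h1 : s ≤ A.outputProb (planeRotation e f √(1 - ε) √ε) S) (h2 : s ≤ A.outputProb 1 S') :
    2 * s - 1 ≤ 2 * (A.queries * (2 * √ε)) := by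
  have hcs : √(1 - ε) ^ 2 + √ε ^ 2 = 1 := by
    rw [Real.sq_sqrt hε.le, Real.sq_sqrt (sub_nonneg.2 hε1)]; ring
  -- A single fixed oracle suffices here, so the average is over one point.
  refine A.two_mul_sub_one_le_queries (w := fun _ : Unit => 1)
    (U := fun _ => planeRotation e f √(1 - ε) √ε) (V := 1) (fun _ => zero_le_one) (by simp)
    (fun _ => planeRotation_mem_unitaryGroup h hcs) (one_mem _) (by positivity) (fun μ y => ?_) hS
    (by simpa using h1) h2
  have h3 := normSq2_op_planeRotation_sub_le h hcs μ y
  have h4 := one_sub_sqrt_one_sub_le hε.le hε1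
  rw [mul_pow, Real.sq_sqrt hε.le]
  simp only [Finset.univ_unique, Finset.sum_singleton, one_mul]
  refine h3.trans (mul_le_mul_of_nonneg_right ?_ (normSq2_nonneg y))
  linarith

/-- The uniform superposition of the nonzero labels. -/
def uniformNonzero (n : ℕ) [NeZero n] : Fin n → ℂ :=
  fun i => if i = 0 then 0 else ((1 / √((n : ℝ) - 1) : ℝ) : ℂ)

theorem star_uniformNonzero (i : Fin n) : star (uniformNonzero n i) = uniformNonzero n i := by
  by_cases h : i = 0 <;> simp [uniformNonzero, h, Complex.conj_ofReal]

theorem sum_uniformNonzero_mul_self (hn : 2 ≤ n) :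
    ∑ i, uniformNonzero n i * uniformNonzero n i = 1 := by
  have hn' : (2 : ℝ) ≤ n := by exact_mod_cast hn
  have hn1 : (0 : ℝ) < n - 1 := by linarith
  have h : ∀ i : Fin n, i ∈ Finset.univ.erase (0 : Fin n) →
      uniformNonzero n i * uniformNonzero n i = ((1 / ((n : ℝ) - 1) : ℝ) : ℂ) := fun i hi => by
    rw [uniformNonzero, if_neg (Finset.ne_of_mem_erase hi), ← Complex.ofReal_mul,
      div_mul_div_comm, one_mul, Real.mul_self_sqrt hn1.le]
  rw [← Finset.add_sum_erase _ _ (Finset.mem_univ (0 : Fin n)),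
    Finset.sum_congr rfl h, Finset.sum_const, Finset.card_erase_of_mem (Finset.mem_univ _),
    Finset.card_univ, Fintype.card_fin, nsmul_eq_mul, Nat.cast_sub NeZero.one_le, Nat.cast_one,
    uniformNonzero, if_pos rfl, zero_mul, zero_add]
  have : (n : ℂ) - 1 ≠ 0 := by exact_mod_cast hn1.ne'
  push_cast
  field_simp

theorem sqrt_hardDist_apply (hε : 0 ≤ ε) (i : Fin n) :
    (√(hardDist n ε i) : ℂ) = (√(1 - ε) : ℂ) * (if i = 0 then 1 else 0) +
      (√ε : ℂ) * uniformNonzero n i := by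
  by_cases h : i = 0
  · simp [hardDist, uniformNonzero, h]
  · rw [hardDist, if_neg h, Real.sqrt_div hε, uniformNonzero, if_neg h, if_neg h]
    push_cast
    ring

/-- The square roots of the hard probabilities form a vector in the plane of |0⟩ and the uniform
superposition of the other labels; rotating |0⟩ within that plane prepares it. -/
theorem quantumSample_lower_bound (hn : 2 ≤ n) (hε : 0 < ε) (hε1 : ε ≤ 1)
    (A : QueryAlgorithm (Fin n)) {s : ℝ} {S S' : Set ℝ} (hS : Disjoint S S')
    (h1 : quantumSample.Succeeds A s (hardDist n ε) S)
    (h2 : quantumSample.Succeeds A s (pointMass n) S') :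
    2 * s - 1 ≤ 2 * (A.queries * (2 * √ε)) := by
  have hcs : √(1 - ε) ^ 2 + √ε ^ 2 = 1 := by
    rw [Real.sq_sqrt hε.le, Real.sq_sqrt (sub_nonneg.2 hε1)]; ring
  have hef : IsRealOrthonormal (Pi.single 0 1) (uniformNonzero n) :=
    ⟨by rw [Pi.star_single, star_one], funext star_uniformNonzero, by simp,
      sum_uniformNonzero_mul_self hn, by simp [uniformNonzero]⟩
  refine rotation_lower_bound hε hε1 hef A hS
    (h1 _ ⟨planeRotation_mem_unitaryGroup hef hcs, fun i => ?_⟩)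
    (h2 _ ⟨one_mem _, fun i => ?_⟩)
  · have h := congrFun (planeRotation_mulVec hef √(1 - ε) √ε) i
    rw [Matrix.mulVec_single_one] at h
    rw [sqrt_hardDist_apply hε.le]
    simpa [Pi.single_apply] using h
  · by_cases h : i = 0 <;> simp [pointMass, Matrix.one_apply, h]

/-- With ψᵢ = |i⟩ on both inputs, the rotation argument carries over to the diagonal vectors |i⟩|i⟩.
-/
theorem purified_lower_bound (hn : 2 ≤ n) (hε : 0 < ε) (hε1 : ε ≤ 1)
    (A : QueryAlgorithm (Fin n × Fin n)) {s : ℝ} {S S' : Set ℝ} (hS : Disjoint S S')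
    (h1 : purified.Succeeds A s (hardDist n ε) S)
    (h2 : purified.Succeeds A s (pointMass n) S') :
    2 * s - 1 ≤ 2 * (A.queries * (2 * √ε)) := by
  have hcs : √(1 - ε) ^ 2 + √ε ^ 2 = 1 := by
    rw [Real.sq_sqrt hε.le, Real.sq_sqrt (sub_nonneg.2 hε1)]; ring
  have hef : IsRealOrthonormal (Pi.single (0, 0) 1)
      (fun x : Fin n × Fin n => if x.1 = x.2 then uniformNonzero n x.2 else 0) := by
    refine ⟨by rw [Pi.star_single, star_one], funext fun x => ?_, by simp, ?_,
      by simp [uniformNonzero]⟩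
    · by_cases h : x.1 = x.2
      · simpa [h] using star_uniformNonzero x.2
      · simp [h]
    · simpa [dotProduct, Fintype.sum_prod_type] using sum_uniformNonzero_mul_self hn
  have hψ : Orthonormal ℂ fun i : Fin n => EuclideanSpace.single i (1 : ℂ) :=
    EuclideanSpace.orthonormal_single
  refine rotation_lower_bound hε hε1 hef A hS
    (h1 _ ⟨planeRotation_mem_unitaryGroup hef hcs, _, hψ, fun a i => ?_⟩)
    (h2 _ ⟨one_mem _, _, hψ, fun a i => ?_⟩)
  · have h := congrFun (planeRotation_mulVec hef √(1 - ε) √ε) (a, i)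
    rw [Matrix.mulVec_single_one] at h
    rw [sqrt_hardDist_apply hε.le]
    refine h.trans ?_
    by_cases hi : i = 0 <;> by_cases ha : a = i <;>
      simp [Pi.single_apply, hi, ha, uniformNonzero]
  · by_cases hi : i = 0 <;> by_cases ha : a = 0 <;>
      simp [pointMass, Matrix.one_apply, hi, ha]

/-! ### The common bound and its consequences -/

/-- In every model, telling `hardDist n ε` from `pointMass n` takes of the order of `1 / √ε`
queries. -/
theorem lower_bound (hn : 2 ≤ n) (hε : 0 < ε) (hε1 : ε ≤ 1) (M : InputModel)
    (hM : M.Represents (hardDist n ε)) (A : QueryAlgorithm (M.Reg n)) {s : ℝ} {S S' : Set ℝ}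
    (hS : Disjoint S S') (h1 : M.Succeeds A s (hardDist n ε) S)
    (h2 : M.Succeeds A s (pointMass n) S') :
    2 * s - 1 ≤ 2 * (A.queries * (2 * √ε)) := by
  cases M with
  | frequency m =>
    obtain ⟨u, hu⟩ := hM
    exact frequency_lower_bound hε hu A hS h1 h2
  | samples m => exact samples_lower_bound hn hε hε1 A hS h1 h2
  | quantumSample => exact quantumSample_lower_bound hn hε hε1 A hS h1 h2
  | purified => exact purified_lower_bound hn hε hε1 A hS h1 h2

/-- √(ε / 2) is below both √ε and the Hellinger distance, so this form yields both bounds. The 8 is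
4 times the crude factor in √ε ≤ 2√(ε / 2). -/
theorem distinguishes_lower_bound (hn : 2 ≤ n) (hε : 0 < ε) (hε1 : ε ≤ 1) {M : InputModel}
    (hM : M.Represents (hardDist n ε)) {A : QueryAlgorithm (M.Reg n)} {s : ℝ}
    (h : M.Distinguishes A s (hardDist n ε) (pointMass n)) :
    (2 * s - 1) / 8 / √(ε / 2) ≤ A.queries := by
  have h3 := lower_bound hn hε hε1 M hM A (by simp) h.1 h.2
  have h4 : 0 < √ε := Real.sqrt_pos.2 hε
  have h5 : √ε ≤ 2 * √(ε / 2) := by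
    refine Real.sqrt_le_iff.2 ⟨by positivity, ?_⟩
    rw [mul_pow, Real.sq_sqrt (by positivity)]
    linarith
  rw [div_le_iff₀ (by positivity)]
  nlinarith [(Nat.cast_nonneg A.queries : (0 : ℝ) ≤ A.queries)]

/-- The admissible interval is {0} for the point mass and lies in the positive reals for the hard
distribution. For n = 2 and ε = 1 the latter has entropy 0 too, hence the strict bound on ε. -/
theorem estimatesEntropy_lower_bound (hn : 2 ≤ n) (hε : 0 < ε) (hε1 : ε < 1) {M : InputModel}
    (hM : M.Represents (hardDist n ε)) {A : QueryAlgorithm (M.Reg n)} {s γ : ℝ} (hγ : 1 < γ)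
    (h : M.EstimatesEntropy A s γ) : (2 * s - 1) / 4 / √ε ≤ A.queries := by
  have hS : Disjoint (Set.Icc (shannonEntropy (hardDist n ε) / γ)
      (γ * shannonEntropy (hardDist n ε)))
      (Set.Icc (shannonEntropy (pointMass n) / γ) (γ * shannonEntropy (pointMass n))) := by
    rw [shannonEntropy_pointMass, zero_div, mul_zero, Set.Icc_self, Set.disjoint_singleton_right]
    intro h0
    exact absurd h0.1 (not_le.2 (div_pos (shannonEntropy_hardDist_pos hn hε hε1) (by linarith)))
  have h3 := lower_bound hn hε hε1.le M hM A hS (h _ (hardDist_mem_stdSimplex hn hε.le hε1.le))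
    (h _ pointMass_mem_stdSimplex)
  rw [div_le_iff₀ (Real.sqrt_pos.2 hε)]
  linarith

/-- For long enough strings, some hard distribution with small parameter has a representation in
the model. -/
theorem exists_represents_hardDist (hn : 2 ≤ n) {K k : ℝ} (hK : 2 ≤ K) (hk : 0 < k)
    (M : InputModel) (hM : ∀ m : ℕ, M = .frequency m → K * (n : ℝ) ^ (2 * k + 1) ≤ m) :
    ∃ ε : ℝ, 0 < ε ∧ ε < 1 ∧ ε ≤ 1 / (K * (n : ℝ) ^ (2 * k)) ∧ M.Represents (hardDist n ε) := by
  have hn' : (2 : ℝ) ≤ n := by exact_mod_cast hn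
  have hpow : 1 ≤ (n : ℝ) ^ (2 * k) := Real.one_le_rpow (by linarith) (by linarith)
  have hpos : 0 < K * (n : ℝ) ^ (2 * k) := by positivity
  have hgt : 1 / (K * (n : ℝ) ^ (2 * k)) < 1 := by
    rw [div_lt_one hpos]; nlinarith
  have default : M.Represents (hardDist n (1 / (K * (n : ℝ) ^ (2 * k)))) →
      ∃ ε : ℝ, 0 < ε ∧ ε < 1 ∧ ε ≤ 1 / (K * (n : ℝ) ^ (2 * k)) ∧ M.Represents (hardDist n ε) :=
    fun h => ⟨_, by positivity, hgt, le_rfl, h⟩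
  cases M with
  | frequency m =>
    have hm := hM m rfl
    rw [Real.rpow_add (by linarith), Real.rpow_one] at hm
    have hKn : 1 ≤ K * (n : ℝ) ^ (2 * k) := by nlinarith
    have hnm : (n : ℝ) ≤ m := by nlinarith
    have hm0 : (0 : ℝ) < m := by linarith
    -- The extra factor n in the required length absorbs the n - 1 nonzero entries of the string.
    have hle : ((n : ℝ) - 1) / m ≤ 1 / (K * (n : ℝ) ^ (2 * k)) := by
      rw [div_le_div_iff₀ hm0 hpos]
      nlinarith
    exact ⟨_, div_pos (by linarith) hm0, hle.trans_lt hgt, hle,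
      exists_frequencies_eq_hardDist (by exact_mod_cast hnm) hn⟩
  | samples m => exact default trivial
  | quantumSample => exact default trivial
  | purified => exact default trivial

end InputModel

end

/-! ### Assembly and choice of constants -/

theorem mainTheorem5 :
    -- the hard pair: its Hellinger distance and its entropies
    (∀ (n : ℕ) [NeZero n], 2 ≤ n → ∀ ε : ℝ, 0 ≤ ε → ε ≤ 1 →
      hardDist n ε ∈ stdSimplex ℝ (Fin n) ∧ pointMass n ∈ stdSimplex ℝ (Fin n) ∧
      hellingerDist (hardDist n ε) (pointMass n) = √(1 - √(1 - ε)) ∧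
      √(ε / 2) ≤ hellingerDist (hardDist n ε) (pointMass n) ∧
      hellingerDist (hardDist n ε) (pointMass n) ≤ √ε ∧
      shannonEntropy (pointMass n) = 0 ∧
      shannonEntropy (hardDist n ε) =
        -(1 - ε) * Real.logb 2 (1 - ε) - ε * Real.logb 2 ε + ε * Real.logb 2 ((n : ℝ) - 1) ∧
      (ε ≤ 1 / 2 → ε * Real.logb 2 n ≤ shannonEntropy (hardDist n ε)) ∧
      (3 ≤ n → ε / 2 * Real.logb 2 n ≤ shannonEntropy (hardDist n ε))) ∧
    ∀ s : ℝ, 1 / 2 < s →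
      (∃ c : ℝ, 0 < c ∧ ∀ (n : ℕ) [NeZero n], 2 ≤ n → ∀ M : InputModel,
        -- every algorithm that distinguishes the pair
        (∀ ε : ℝ, 0 < ε → ε ≤ 1 → M.Represents (hardDist n ε) →
          ∀ A : QueryAlgorithm (M.Reg n), M.Distinguishes A s (hardDist n ε) (pointMass n) →
            c / hellingerDist (hardDist n ε) (pointMass n) ≤ A.queries ∧
            c / √ε ≤ A.queries) ∧
        -- every algorithm that estimates the entropy of all distributions
        (∀ ε : ℝ, 0 < ε → ε < 1 → M.Represents (hardDist n ε) →
          ∀ γ : ℝ, 1 < γ → ∀ A : QueryAlgorithm (M.Reg n), M.EstimatesEntropy A s γ →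
            c / √ε ≤ A.queries) ∧
        -- the choice `ε = n ^ (-k)`
        (∀ k : ℝ, 0 < k → M.Represents (hardDist n ((n : ℝ) ^ (-k))) →
          ∀ A : QueryAlgorithm (M.Reg n),
            (M.Distinguishes A s (hardDist n ((n : ℝ) ^ (-k))) (pointMass n) ∨
              ∃ γ : ℝ, 1 < γ ∧ M.EstimatesEntropy A s γ) →
            c * (n : ℝ) ^ (k / 2) ≤ A.queries)) ∧
      -- polynomially many queries never suffice (in the frequency model, for long strings)
      ∀ C k : ℝ, 0 < k → ∃ K : ℝ, ∀ (n : ℕ) [NeZero n], 2 ≤ n → ∀ M : InputModel,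
        (∀ m : ℕ, M = .frequency m → K * (n : ℝ) ^ (2 * k + 1) ≤ m) →
        ¬ ∃ (γ : ℝ) (A : QueryAlgorithm (M.Reg n)),
          1 < γ ∧ (A.queries : ℝ) ≤ C * (n : ℝ) ^ k ∧ M.EstimatesEntropy A s γ := by
  refine ⟨fun n _ hn ε h0 h1 => ?_, fun s hs => ⟨⟨(2 * s - 1) / 8, by linarith, ?_⟩, ?_⟩⟩
  · have hd := hellingerDist_hardDist hn h0 h1
    refine ⟨hardDist_mem_stdSimplex hn h0 h1, pointMass_mem_stdSimplex, hd, ?_, ?_,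
      shannonEntropy_pointMass, shannonEntropy_hardDist hn,
      mul_logb_le_shannonEntropy_hardDist hn h0,
      fun hn3 => half_mul_logb_le_shannonEntropy_hardDist hn3 h0 h1⟩
    · rw [hd]; exact Real.sqrt_le_sqrt (half_le_one_sub_sqrt_one_sub h1)
    · rw [hd]; exact Real.sqrt_le_sqrt (one_sub_sqrt_one_sub_le h0 h1)
  · intro n _ hn M
    have hc : 0 ≤ (2 * s - 1) / 8 := by linarith
    have dist : ∀ ε : ℝ, 0 < ε → ε ≤ 1 → M.Represents (hardDist n ε) →
        ∀ A : QueryAlgorithm (M.Reg n), M.Distinguishes A s (hardDist n ε) (pointMass n) →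
          (2 * s - 1) / 8 / hellingerDist (hardDist n ε) (pointMass n) ≤ A.queries ∧
          (2 * s - 1) / 8 / √ε ≤ A.queries := by
      intro ε h0 h1 hM A hA
      have h := InputModel.distinguishes_lower_bound hn h0 h1 hM hA
      have hpos : 0 < √(ε / 2) := Real.sqrt_pos.2 (by linarith)
      rw [hellingerDist_hardDist hn h0.le h1]
      exact ⟨(div_le_div_of_nonneg_left hc hpos
          (Real.sqrt_le_sqrt (half_le_one_sub_sqrt_one_sub h1))).trans h,
        (div_le_div_of_nonneg_left hc hpos (Real.sqrt_le_sqrt (by linarith))).trans h⟩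
    have est : ∀ ε : ℝ, 0 < ε → ε < 1 → M.Represents (hardDist n ε) →
        ∀ γ : ℝ, 1 < γ → ∀ A : QueryAlgorithm (M.Reg n), M.EstimatesEntropy A s γ →
          (2 * s - 1) / 8 / √ε ≤ A.queries := fun ε h0 h1 hM γ hγ A hA =>
      (div_le_div_of_nonneg_right (by linarith) (Real.sqrt_nonneg ε)).trans
        (InputModel.estimatesEntropy_lower_bound hn h0 h1 hM hγ hA)
    refine ⟨dist, est, fun k hk hM A hA => ?_⟩
    have hn' : (2 : ℝ) ≤ n := by exact_mod_cast hn
    have hε0 : 0 < (n : ℝ) ^ (-k) := Real.rpow_pos_of_pos (by linarith) _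
    have hε1 : (n : ℝ) ^ (-k) < 1 :=
      Real.rpow_lt_one_of_one_lt_of_neg (by linarith) (by linarith)
    have hsqrt : (2 * s - 1) / 8 / √((n : ℝ) ^ (-k)) = (2 * s - 1) / 8 * (n : ℝ) ^ (k / 2) := by
      rw [Real.sqrt_eq_rpow, ← Real.rpow_mul (by linarith), div_eq_mul_inv,
        ← Real.rpow_neg (by linarith)]
      congr 2
      ring
    rw [← hsqrt]
    rcases hA with hA | ⟨γ, hγ, hA⟩
    · exact (dist _ hε0 hε1.le hM A hA).2
    · exact est _ hε0 hε1 hM γ hγ A hA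
  · intro C k hk
    have hc : 0 < (2 * s - 1) / 4 := by linarith
    -- With c = (2s - 1) / 4, the square makes c / √ε at least (|C| + c) n^k. The inner 1 makes this
    -- exceed C n^k strictly; the outer 1 ensures K ≥ 2, which keeps ε below 1.
    refine ⟨(|C| / ((2 * s - 1) / 4) + 1) ^ 2 + 1, fun n _ hn M hM => ?_⟩
    rintro ⟨γ, A, hγ, hA, hest⟩
    have hn' : (2 : ℝ) ≤ n := by exact_mod_cast hn
    set c := (2 * s - 1) / 4
    set K := (|C| / c + 1) ^ 2 + 1 with hK
    have hb : 0 ≤ |C| / c := by positivity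
    obtain ⟨ε, hε0, hε1, hε, hrep⟩ :=
      InputModel.exists_represents_hardDist hn (K := K) (by nlinarith) hk M hM
    have h := InputModel.estimatesEntropy_lower_bound hn hε0 hε1 hrep hγ hest
    have hpow : 0 < (n : ℝ) ^ k := Real.rpow_pos_of_pos (by linarith) _
    have hsqrt : √ε * ((|C| / c + 1) * (n : ℝ) ^ k) ≤ 1 := by
      rw [← Real.sqrt_sq (show 0 ≤ (|C| / c + 1) * (n : ℝ) ^ k by positivity),
        ← Real.sqrt_mul hε0.le, Real.sqrt_le_iff, one_pow, mul_pow, ← Real.rpow_natCast (_ ^ k),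
        ← Real.rpow_mul (by linarith)]
      refine ⟨zero_le_one, ?_⟩
      have h2 : (n : ℝ) ^ (k * ((2 : ℕ) : ℝ)) = (n : ℝ) ^ (2 * k) := by
        rw [mul_comm]; norm_cast
      rw [h2]
      have h3 : 0 < (n : ℝ) ^ (2 * k) := Real.rpow_pos_of_pos (by linarith) _
      rw [le_div_iff₀ (by positivity)] at hε
      nlinarith [mul_pos hε0 h3]
    have h4 : c ≤ C * (n : ℝ) ^ k * √ε :=
      ((div_le_iff₀ (Real.sqrt_pos.2 hε0)).1 (h.trans hA))
    have h5 : |C| = c * (|C| / c) := by field_simp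
    have h6 : C * (n : ℝ) ^ k * √ε ≤ |C| * ((n : ℝ) ^ k * √ε) := by
      rw [mul_assoc]; exact mul_le_mul_of_nonneg_right (le_abs_self C) (by positivity)
    have h7 : 0 < (n : ℝ) ^ k * √ε := mul_pos hpow (Real.sqrt_pos.2 hε0)
    nlinarith [mul_le_mul_of_nonneg_left hsqrt hc.le, mul_pos hc h7]
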